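/- Let $\mathcal U,\mathcal X,\mathcal Y,\mathcal A_v,\mathcal M,\mathcal N,\hat{\mathcal U}$ be finite alphabets, $P_U$ a probability distribution on $\mathcal U$, $P_{Y|U,A_v}$ a channel, $\Lambda:\mathcal U\times\hat{\mathcal U}\to\mathbb R$ a distortion function, $C:\mathcal A_v\to\mathbb R$ a cost function, $\Gamma\in\mathbb R$, $d\ge 0$ an integer (the lookahead), and $f_m:\mathcal M\times\mathcal X\to\mathcal M$, $f_n:\mathcal N\times\mathcal Y\to\mathcal N$ time-invariant memory updates. Fix a stationary decoder $\hat U:\mathcal X\times\mathcal Y\times\mathcal M\times\mathcal N\to\hat{\mathcal U}$ and a stationary actuator $A_v:\mathcal M\times\mathcal X\to\mathcal A_v$. *System.* The state at time $i\ge 0$ is $S_i=(V_i,M_i,N_i)$ with $V_i=(U_i,\dots,U_{i+d})$. The initial state $S_0$ has a law $\nu$ on $\mathcal S=\mathcal U^{d+1}\times\mathcal M\times\mathcal N$; the further source symbols $U_{d+1},U_{d+2},\dots$ are i.i.d. $\sim P_U$ and independent of $S_0$. At time $i\ge 1$ the encoder emits $X_i=f_{e,i}(S_0,U_{d+1},\dots,U_{i+d},Y_1,\dots,Y_{i-1})$,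 where the $f_{e,i}$ are arbitrary functions; the action is $A_{v,i}=A_v(M_{i-1},X_i)$; given the past and the whole source sequence, the side information $Y_i$ has law $P_{Y|U,A_v}(\cdot|U_i,A_{v,i})$; the reconstruction is $\hat U_i=\hat U(X_i,Y_i,M_{i-1},N_{i-1})$; and $M_i=f_m(M_{i-1},X_i)$, $N_i=f_n(N_{i-1},Y_i)$. Let $$D_{\hat U,A_v}(d)=\inf\Big\{\limsup_{K\to\infty}\frac1K\sum_{i=1}^K\mathbb E\,\Lambda(U_i,\hat U_i)\Big\}\in[-\infty,+\infty],$$ the infimum being over all initial laws $\nu$ and encoders $(f_{e,i})_{i\ge1}$ with $\limsup_{K}\frac1K\sum_{i=1}^K\mathbb E\,C(A_{v,i})\le\Gamma$ (it is $+\infty$ if there are none), and let $D_a^{FB}(d,\mathcal M,\mathcal N)=\inf_{\hat U,A_v}D_{\hat U,A_v}(d)$ over all stationary decoders and actuators. *Optimality equation.* For $\lambda\ge0$, a state $s=(u_1,\dots,u_{d+1},m,n)$ and an action $a:\mathcal U^{d+1}\to\mathcal X$, put $\tilde v=(u_2,\dots,u_{d+1},\tilde u)$ with first coordinate $\tilde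 v_1$, $\tilde x=a(\tilde v)$, $$E_{s,a}[\varphi]=\sum_{\tilde u\in\mathcal U,\,\tilde y\in\mathcal Y}P_U(\tilde u)\,P_{Y|U,A_v}(\tilde y\,|\,\tilde v_1,A_v(m,\tilde x))\,\varphi(\tilde v,\tilde x,\tilde y),$$ $$g^\lambda(s,a)=-E_{s,a}\big[\Lambda(\tilde v_1,\hat U(\tilde x,\tilde y,m,n))\big]+\lambda\Big(\Gamma-\sum_{\tilde u}P_U(\tilde u)\,C(A_v(m,\tilde x))\Big).$$ Say that $\rho^\lambda,h^\lambda:\mathcal S\to\mathbb R$ solve the average cost optimality equation for $\lambda$ if for every $s\in\mathcal S$ $$\rho^\lambda(s)+h^\lambda(s)=\max_{a}\Big[g^\lambda(s,a)+E_{s,a}\big[h^\lambda(\tilde v,f_m(m,\tilde x),f_n(n,\tilde y))\big]\Big]$$ and the maximum is attained at some $a$ for which also $E_{s,a}[\rho^\lambda(\tilde v,f_m(m,\tilde x),f_n(n,\tilde y))]=\rho^\lambda(s)$ (this holds automatically if $\rho^\lambda$ is constant). **Theorem.** If $(\rho^\lambda,h^\lambda)$ solves the average cost optimality equation for every $\lambda\ge0$,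 then $$D_{\hat U,A_v}(d)=-\inf_{\lambda\ge0}\ \sup_{x\in\mathcal U^{d+1}\times\mathcal M\times\mathcal N}\rho^\lambda(x).$$ In particular, if $(\hat U,A_v)=(\hat U^{opt},A_v^{opt})$ is optimal, i.e. $D_{\hat U,A_v}(d)\le D_{\hat U',A_v'}(d)$ for all stationary $\hat U',A_v'$, then $$D_a^{FB}(d,\mathcal M,\mathcal N)=-\inf_{\lambda\ge0}\ \sup_{x\in\mathcal U^{d+1}\times\mathcal M\times\mathcal N}\rho^\lambda(x).$$ -/

import Mathlib

open Filter

noncomputable section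

/-- Sequential source coding with a side information vending machine and stationary memories.
Alphabets: source `U`, encoded symbols `X`, side information `Y`, vending actions `A`,
Memory X `M`, Memory Y `N`, reconstructions `R`. -/
structure VendingMachine (U X Y A M N R : Type*) [Fintype U] [Fintype Y] where
  /-- `P_U` -/
  source : stdSimplex ℝ U
  /-- `P_{Y|U,A}` -/
  channel : U → A → stdSimplex ℝ Y
  /-- the distortion function `Λ` -/
  distortion : U → R → ℝ
  /-- the cost of a vending action -/
  cost : A → ℝ
  /-- the cost constraint `Γ` -/
  budget : ℝ
  /-- time invariant update of Memory X: `M_i = f_m(M_{i-1}, X_i)` -/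
  updM : M → X → M
  /-- time invariant update of Memory Y: `N_i = f_n(N_{i-1}, Y_i)` -/
  updN : N → Y → N

namespace VendingMachine

/-- A state `(u_1, …, u_{d+1}, m, n)`: the window of source symbols seen by an encoder with
lookahead `d`, and the contents of the two memories. -/
abbrev State (d : ℕ) (U M N : Type*) : Type _ := (Fin (d + 1) → U) × M × N

/-- A stationary decoder `Û(x, y, m, n)`. -/
abbrev Decoder (X Y M N R : Type*) : Type _ := X → Y → M → N → R

/-- A stationary actuator `A_v(m, x)`. -/
abbrev Actuator (X A M : Type*) : Type _ := M → X → A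

/-- An encoder with lookahead `d` and unit delay feedback: a sequence of arbitrary
(history dependent, deterministic) encoding functions. The `i`-th one produces the encoded symbol
at time `i + 1`. Its arguments are the initial state `S_0`, whose window is `(U_0, …, U_d)`, the
further source symbols `U_{d+1}, …, U_{d+i+1}`, and the past side information `Y_1, …, Y_i`. -/
abbrev Encoder (d : ℕ) (U X Y M N : Type*) : Type _ :=
  (i : ℕ) → State d U M N → (Fin (i + 1) → U) → (Fin i → Y) → X

/-- `(u_1, …, u_{d+1}), ũ ↦ (u_2, …, u_{d+1}, ũ)` -/
def slide {d : ℕ} {U : Type*} (v : Fin (d + 1) → U) (u : U) : Fin (d + 1) → U :=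
  Fin.snoc (α := fun _ => U) (Fin.tail v) u

variable {U X Y A M N R : Type*} [Fintype U] [Fintype X] [Fintype Y] [Fintype M] [Fintype N]
variable {d : ℕ}

/-- The encoded symbol at time `i + 1`. Here `w j = (U_{d+j+1}, Y_{j+1})`. -/
def encoded (e : Encoder d U X Y M N) (i : ℕ) (s₀ : State d U M N) (w : Fin (i + 1) → U × Y) : X :=
  e i s₀ (fun j => (w j).1) (fun j => (w j.castSucc).2)

/-- The state `S_i = (V_i, M_i, N_i)`, with `V_i = (U_i, …, U_{i+d})`, when the initial state is
`s₀` and the next `i` source symbols and side information symbols are given by `w`. -/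
def state (S : VendingMachine U X Y A M N R) (e : Encoder d U X Y M N) :
    (i : ℕ) → State d U M N → (Fin i → U × Y) → State d U M N
  | 0, s₀, _ => s₀
  | i + 1, s₀, w =>
    let s := state S e i s₀ (fun j => w j.castSucc)
    (slide s.1 (w (Fin.last i)).1,
      S.updM s.2.1 (encoded e i s₀ w),
      S.updN s.2.2 (w (Fin.last i)).2)

/-- The source symbol `U_{i+1}`. -/
def symbol (S : VendingMachine U X Y A M N R) (e : Encoder d U X Y M N) (i : ℕ)
    (s₀ : State d U M N) (w : Fin (i + 1) → U × Y) : U :=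
  (S.state e (i + 1) s₀ w).1 0

/-- The vending action at time `i + 1`. -/
def action (S : VendingMachine U X Y A M N R) (act : Actuator X A M) (e : Encoder d U X Y M N)
    (i : ℕ) (s₀ : State d U M N) (w : Fin (i + 1) → U × Y) : A :=
  act (S.state e i s₀ (fun j => w j.castSucc)).2.1 (encoded e i s₀ w)

/-- The reconstruction at time `i + 1`. -/
def reconstruction (S : VendingMachine U X Y A M N R) (dec : Decoder X Y M N R)
    (e : Encoder d U X Y M N) (i : ℕ) (s₀ : State d U M N) (w : Fin (i + 1) → U × Y) : R :=
  dec (encoded e i s₀ w) (w (Fin.last i)).2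
    (S.state e i s₀ (fun j => w j.castSucc)).2.1 (S.state e i s₀ (fun j => w j.castSucc)).2.2

/-- The probability of `(U_{d+1}, Y_1), …, (U_{d+i}, Y_i)` given the initial state `s₀`: the new
source symbols are i.i.d. with law `P_U`, and the side information comes from the memoryless
channel `P_{Y|U,A}` used with the current source symbol and the current vending action. -/
def prob (S : VendingMachine U X Y A M N R) (act : Actuator X A M) (e : Encoder d U X Y M N) :
    (i : ℕ) → State d U M N → (Fin i → U × Y) → ℝ
  | 0, _, _ => 1
  | i + 1, s₀, w =>
    prob S act e i s₀ (fun j => w j.castSucc) * (S.source (w (Fin.last i)).1 *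
      S.channel (S.symbol e i s₀ w) (S.action act e i s₀ w) (w (Fin.last i)).2)

/-- `E[Λ(U_{i+1}, Û_{i+1})]` for the initial law `ν` of `S_0` and the encoder `e`. -/
def expDistortion (S : VendingMachine U X Y A M N R) (dec : Decoder X Y M N R)
    (act : Actuator X A M) (ν : stdSimplex ℝ (State d U M N)) (e : Encoder d U X Y M N)
    (i : ℕ) : ℝ :=
  ∑ s₀, ν s₀ * ∑ w : Fin (i + 1) → U × Y, S.prob act e (i + 1) s₀ w *
    S.distortion (S.symbol e i s₀ w) (S.reconstruction dec e i s₀ w)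

/-- `E[C(A_{v,i+1})]` for the initial law `ν` of `S_0` and the encoder `e`. -/
def expCost (S : VendingMachine U X Y A M N R)
    (act : Actuator X A M) (ν : stdSimplex ℝ (State d U M N)) (e : Encoder d U X Y M N)
    (i : ℕ) : ℝ :=
  ∑ s₀, ν s₀ * ∑ w : Fin (i + 1) → U × Y, S.prob act e (i + 1) s₀ w *
    S.cost (S.action act e i s₀ w)

/-- Long-run (limsup) expected average distortion. -/
def avgDistortion (S : VendingMachine U X Y A M N R) (dec : Decoder X Y M N R)
    (act : Actuator X A M) (ν : stdSimplex ℝ (State d U M N)) (e : Encoder d U X Y M N) : EReal :=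
  limsup (fun K : ℕ =>
    (((1 / K : ℝ) * ∑ i ∈ Finset.range K, S.expDistortion dec act ν e i : ℝ) : EReal)) atTop

/-- Long-run (limsup) expected average cost of the vending actions. -/
def avgCost (S : VendingMachine U X Y A M N R)
    (act : Actuator X A M) (ν : stdSimplex ℝ (State d U M N)) (e : Encoder d U X Y M N) : EReal :=
  limsup (fun K : ℕ =>
    (((1 / K : ℝ) * ∑ i ∈ Finset.range K, S.expCost act ν e i : ℝ) : EReal)) atTop

/-- The optimal distortion with lookahead `d` for a given stationary decoder and actuator: the
infimum over the initial laws and the encoders that meet the cost constraint. -/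
def encoderOptimalDistortion (S : VendingMachine U X Y A M N R) (d : ℕ)
    (dec : Decoder X Y M N R) (act : Actuator X A M) : EReal :=
  ⨅ (ν : stdSimplex ℝ (State d U M N)) (e : Encoder d U X Y M N)
    (_ : S.avgCost act ν e ≤ (S.budget : EReal)), S.avgDistortion dec act ν e

/-- The optimal distortion with lookahead `d` over all stationary decoders, all stationary
actuators, all initial laws and all encoders that meet the cost constraint. -/
def optimalDistortion (S : VendingMachine U X Y A M N R) (d : ℕ) : EReal :=
  ⨅ (dec : Decoder X Y M N R) (act : Actuator X A M), S.encoderOptimalDistortion d dec act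

/-- The stationary decoder `dec` and actuator `act` are optimal among all stationary ones. -/
def IsOptimalPair (S : VendingMachine U X Y A M N R) (d : ℕ)
    (dec : Decoder X Y M N R) (act : Actuator X A M) : Prop :=
  ∀ dec' act', S.encoderOptimalDistortion d dec act ≤ S.encoderOptimalDistortion d dec' act'

/-- The expectation, in state `(v, m, n)` under the encoding action `a`, of a function of the next
window, of the encoded symbol `x̃` and of the side information `ỹ`. -/
def stepExp (S : VendingMachine U X Y A M N R) (act : Actuator X A M) (s : State d U M N)
    (a : (Fin (d + 1) → U) → X) (φ : (Fin (d + 1) → U) → X → Y → ℝ) : ℝ :=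
  ∑ u : U, ∑ y : Y, S.source u *
    S.channel (slide s.1 u 0) (act s.2.1 (a (slide s.1 u))) y *
      φ (slide s.1 u) (a (slide s.1 u)) y

/-- The Lagrangian augmented reward `g^λ(s, a) = g(s, a) + λ (Γ - l(s, a))`. -/
def lagrangianReward (S : VendingMachine U X Y A M N R) (dec : Decoder X Y M N R)
    (act : Actuator X A M) (lam : ℝ) (s : State d U M N) (a : (Fin (d + 1) → U) → X) : ℝ :=
  -S.stepExp act s a (fun v x y => S.distortion (v 0) (dec x y s.2.1 s.2.2)) +
    lam * (S.budget - ∑ u : U, S.source u * S.cost (act s.2.1 (a (slide s.1 u))))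

/-- The expectation of a function `h` of the next state. -/
def nextExp (S : VendingMachine U X Y A M N R) (act : Actuator X A M) (h : State d U M N → ℝ)
    (s : State d U M N) (a : (Fin (d + 1) → U) → X) : ℝ :=
  S.stepExp act s a (fun v x y => h (v, S.updM s.2.1 x, S.updN s.2.2 y))

/-- `(ρ, h)` solves the average cost optimality equation with multiplier `lam`:
`ρ(s) + h(s) = max_a [g^λ(s, a) + E h(next state)]` for all states `s`, and the maximum is attained
at some action which preserves `ρ` in the mean (this last condition is void if `ρ` is constant). -/
def SolvesACOE (S : VendingMachine U X Y A M N R) (dec : Decoder X Y M N R)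
    (act : Actuator X A M) (lam : ℝ) (ρ h : State d U M N → ℝ) : Prop :=
  ∀ s,
    IsGreatest (Set.range fun a => S.lagrangianReward dec act lam s a + S.nextExp act h s a)
      (ρ s + h s) ∧
    ∃ a, S.lagrangianReward dec act lam s a + S.nextExp act h s a = ρ s + h s ∧
      S.nextExp act ρ s a = ρ s

end VendingMachine

end

/-! The statement is Lagrangian duality for a controlled Markov chain on finitely many states. After
any history an encoder amounts to an action on the current state, so path expectations are built
from the one-step kernel (`pathExp_succ`).

Weak duality (`neg_le_avgDistortion`): the upper-bound half of the optimality equation, summed along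
any encoder, telescopes in `h`. The average Lagrangian reward is thus at most `sup ρ` up to O(1/K),
and for a feasible encoder the multiplier term is asymptotically nonnegative.

Strong duality: maximizing actions that preserve `ρ` form a stationary policy whose gain is exactly
`ρ` (`exists_policy_gain_eq`). Hence `sup ρ` at multiplier `lam` is bounded by the maximum of
finitely many lines in `lam`, one for each pair (stationary policy, initial state), with intercept
minus the distortion and slope the cost slack. If no pair is feasible, all slopes are negative and
the dual value is `⊥`. Otherwise `exists_multiplier` yields either one feasible pair that suffices,
or two maximal pairs with slacks of opposite sign, to be mixed so that the cost meets the budget.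

Encoders are deterministic, so mixing needs an argument. At distinct initial states the initial law
does it, since the encoder sees `S_0`. If only one initial state is available, it is the unique
maximizer of the harmonic gain, hence absorbing under both policies (`transition_apply_of_isMax`),
and deterministic time sharing works. -/

noncomputable section

/-! ### Mean ergodic theorem in finite dimension, and maxima of finitely many lines. -/

/-- Bounded powers force the range and the kernel of `T - 1` to be disjoint, so that in finite
dimension the Cesàro means of the powers of `T` converge to fixed points. -/
theorem exists_fixed_tendsto_cesaro {ι : Type*} [Fintype ι] (T : (ι → ℝ) →ₗ[ℝ] (ι → ℝ))
    (hT : ∀ φ, ‖T φ‖ ≤ ‖φ‖) (φ : ι → ℝ) :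
    ∃ p : ι → ℝ, T p = p ∧ ∀ s, Tendsto
      (fun K : ℕ => (1 / K : ℝ) * ∑ i ∈ Finset.range K, (T ^ i) φ s) atTop (nhds (p s)) := by
  have hpow : ∀ (n : ℕ) φ, ‖(T ^ n) φ‖ ≤ ‖φ‖ := by
    intro n
    induction n with
    | zero => intro φ; simp
    | succ n ih =>
      intro φ
      rw [pow_succ']
      exact (hT _).trans (ih φ)
  have hdisj : Disjoint (LinearMap.ker (T - 1)) (LinearMap.range (T - 1)) := by
    rw [Submodule.disjoint_def]
    rintro x hx ⟨z, rfl⟩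
    set x := (T - 1) z with hxdef
    have hTx : T x = x := by
      have : T x - x = 0 := by simpa using hx
      exact sub_eq_zero.mp this
    -- A fixed vector `x = T z - z` makes the orbit of `z` drift linearly, which bounded powers
    -- forbid unless `x = 0`.
    have hn : ∀ n : ℕ, (T ^ n) z = z + (n : ℝ) • x := by
      intro n
      induction n with
      | zero => simp
      | succ n ih =>
        rw [pow_succ', Module.End.mul_apply, ih, map_add, map_smul, hTx]
        have : T z = z + x := by simp [hxdef]
        rw [this]
        push_cast
        module
    by_contra hx0
    have hpos : 0 < ‖x‖ := norm_pos_iff.mpr hx0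
    obtain ⟨n, hn'⟩ := exists_nat_gt (2 * ‖z‖ / ‖x‖)
    rw [div_lt_iff₀ hpos] at hn'
    have h1 : (n : ℝ) • x = (T ^ n) z - z := by rw [hn]; simp
    have h2 : ‖(n : ℝ) • x‖ ≤ ‖z‖ + ‖z‖ := by
      rw [h1]
      exact (norm_sub_le _ _).trans (by gcongr; exact hpow n z)
    rw [norm_smul, Real.norm_natCast] at h2
    linarith
  have htop : LinearMap.ker (T - 1) ⊔ LinearMap.range (T - 1) = ⊤ := by
    apply Submodule.eq_top_of_disjoint _ _ _ hdisj
    rw [add_comm, LinearMap.finrank_range_add_finrank_ker]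
  obtain ⟨p, hp, q, ⟨z, rfl⟩, rfl⟩ := Submodule.mem_sup.mp (htop ▸ Submodule.mem_top (x := φ))
  have hTp : T p = p := by
    have : T p - p = 0 := by simpa using hp
    exact sub_eq_zero.mp this
  have hTpn : ∀ n : ℕ, (T ^ n) p = p := by
    intro n
    induction n with
    | zero => simp
    | succ n ih => rw [pow_succ', Module.End.mul_apply, ih, hTp]
  refine ⟨p, hTp, fun s => ?_⟩
  -- The kernel component is constant along the powers; the range component telescopes.
  have hsum : ∀ K : ℕ, ∑ i ∈ Finset.range K, (T ^ i) (p + (T - 1) z) s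
      = K * p s + ((T ^ K) z s - z s) := by
    intro K
    induction K with
    | zero => simp
    | succ n ih =>
      rw [Finset.sum_range_succ, ih, map_add, hTpn]
      have : (T ^ n) ((T - 1) z) = (T ^ (n + 1)) z - (T ^ n) z := by
        rw [pow_succ, Module.End.mul_apply, ← map_sub]; rfl
      rw [this]
      simp only [Pi.add_apply, Pi.sub_apply]
      push_cast
      ring
  have hbd : Tendsto (fun K : ℕ => (1 / K : ℝ) * ((T ^ K) z s - z s)) atTop (nhds 0) := by
    refine tendsto_one_div_atTop_nhds_zero_nat.zero_mul_isBoundedUnder_le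
      (isBoundedUnder_of ⟨2 * ‖z‖, fun K => ?_⟩)
    have h1 := (norm_le_pi_norm ((T ^ K) z) s).trans (hpow K z)
    have h2 := norm_le_pi_norm z s
    have h3 := norm_sub_le ((T ^ K) z s) (z s)
    simp only [Function.comp_apply]
    linarith
  have : Tendsto (fun K : ℕ => p s + (1 / K : ℝ) * ((T ^ K) z s - z s)) atTop (nhds (p s)) := by
    simpa using hbd.const_add (p s)
  refine this.congr' ?_
  filter_upwards [eventually_gt_atTop 0] with K hK
  rw [hsum]
  have : (K : ℝ) ≠ 0 := by positivity
  field_simp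

/-- If the maximum of a finite family of lines does not fall below its value at `a` along `l`, then
some line that attains the maximum at `a` does not decrease along `l`. -/
theorem exists_maximal_slope_nonneg {J : Type*} [Finite J] [Nonempty J] (x y : J → ℝ) {r a : ℝ}
    {l : Filter ℝ} [l.NeBot] (hl : l ≤ nhds a) (hr : ∀ j, x j + a * y j ≤ r)
    (hmin : ∀ᶠ t in l, ∃ j, r ≤ x j + t * y j) :
    ∃ j, x j + a * y j = r ∧ ∃ᶠ t in l, 0 ≤ (t - a) * y j := by
  -- Otherwise each line is eventually below `r` along `l`: by continuity if it is below at `a`, by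
  -- the sign of its slope if it attains `r`. Finiteness makes this simultaneous.
  by_contra! hcon
  have : ∀ j, ∀ᶠ t in l, x j + t * y j < r := by
    intro j
    rcases (hr j).lt_or_eq with hlt | heq
    · have hc : Tendsto (fun t => x j + t * y j) l (nhds (x j + a * y j)) :=
        (Continuous.tendsto (by fun_prop) a).mono_left hl
      exact hc.eventually_lt_const hlt
    · have := hcon j heq
      filter_upwards [this] with t ht
      nlinarith
  obtain ⟨t, ht, j, hj⟩ := ((eventually_all.mpr this).and hmin).exists
  exact absurd (ht j) (not_lt.mpr hj)

/-- A finite form of linear programming duality with one constraint. -/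
theorem exists_multiplier {J : Type*} [Finite J] (x y : J → ℝ) (hy : ∃ j, 0 ≤ y j) :
    ∃ a : ℝ, 0 ≤ a ∧ ((∃ j, 0 ≤ y j ∧ ∀ k, x k + a * y k ≤ x j) ∨
      ∃ j₁ j₂, 0 ≤ y j₁ ∧ y j₂ ≤ 0 ∧ x j₁ + a * y j₁ = x j₂ + a * y j₂ ∧
        ∀ k, x k + a * y k ≤ x j₁ + a * y j₁) := by
  classical
  have : Fintype J := Fintype.ofFinite J
  have hne : Nonempty J := hy.nonempty
  set R : ℝ → ℝ := fun t => Finset.univ.sup' Finset.univ_nonempty (fun j => x j + t * y j)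
  have hle : ∀ t j, x j + t * y j ≤ R t := fun t j =>
    Finset.le_sup' (fun j => x j + t * y j) (Finset.mem_univ j)
  have hex : ∀ t, ∃ j, R t = x j + t * y j := fun t => by
    obtain ⟨j, -, hj⟩ := Finset.exists_mem_eq_sup' Finset.univ_nonempty (fun j => x j + t * y j)
    exact ⟨j, hj⟩
  have hcont : Continuous R :=
    Continuous.finset_sup'_apply _ fun j _ => by fun_prop
  -- A positive slope makes the upper envelope `R` tend to infinity, so it has a minimizer on the
  -- half-line. Without one, a large multiplier pushes every negative slope below the best line of
  -- slope zero.
  by_cases hpos : ∃ j, 0 < y j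
  · obtain ⟨j₀, hj₀⟩ := hpos
    have hlim : Tendsto R atTop atTop := by
      refine tendsto_atTop_mono (fun t => hle t j₀) ?_
      exact tendsto_atTop_add_const_left _ _ (tendsto_id.atTop_mul_const hj₀)
    obtain ⟨b, hb0, hb⟩ : ∃ b : ℝ, 0 ≤ b ∧ ∀ t ≥ b, R 0 ≤ R t := by
      obtain ⟨b, hb⟩ := (hlim.eventually_ge_atTop (R 0)).exists_forall_of_atTop
      exact ⟨max b 0, le_max_right _ _, fun t ht => hb t ((le_max_left _ _).trans ht)⟩
    obtain ⟨a, ⟨ha0, hab⟩, ha⟩ := isCompact_Icc.exists_isMinOn (s := Set.Icc 0 b)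
      ⟨0, le_refl _, hb0⟩ hcont.continuousOn
    have hamin : ∀ t, 0 ≤ t → R a ≤ R t := by
      intro t ht
      rcases le_total t b with h | h
      · exact ha ⟨ht, h⟩
      · exact (ha ⟨le_refl _, hb0⟩ : R a ≤ R 0).trans (hb t h)
    obtain ⟨j₁, hj₁, hy₁⟩ : ∃ j, x j + a * y j = R a ∧ 0 ≤ y j := by
      obtain ⟨j, hj, hf⟩ := exists_maximal_slope_nonneg x y (l := nhdsWithin a (Set.Ioi a))
        nhdsWithin_le_nhds (hle a) (by
          filter_upwards [self_mem_nhdsWithin] with t ht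
          obtain ⟨j, hj⟩ := hex t
          exact ⟨j, hj ▸ hamin t (ha0.trans (le_of_lt ht))⟩)
      obtain ⟨t, ht, ht'⟩ := (hf.and_eventually self_mem_nhdsWithin).exists
      exact ⟨j, hj, nonneg_of_mul_nonneg_right ht (sub_pos.mpr ht')⟩
    -- Approaching the minimizer from the left, which gives a slope `≤ 0`, is possible only when it
    -- is positive; at zero the first alternative holds.
    rcases ha0.eq_or_lt with rfl | hapos
    · exact ⟨0, le_refl _, Or.inl ⟨j₁, hy₁, fun k => by
        have := hle 0 k
        rw [← hj₁] at this
        simpa using this⟩⟩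
    · obtain ⟨j₂, hj₂, hy₂⟩ : ∃ j, x j + a * y j = R a ∧ y j ≤ 0 := by
        obtain ⟨j, hj, hf⟩ := exists_maximal_slope_nonneg x y (l := nhdsWithin a (Set.Iio a))
          nhdsWithin_le_nhds (hle a) (by
            filter_upwards [self_mem_nhdsWithin, nhdsWithin_le_nhds (lt_mem_nhds hapos)] with t _ ht
            obtain ⟨j, hj⟩ := hex t
            exact ⟨j, hj ▸ hamin t (le_of_lt ht)⟩)
        obtain ⟨t, ht, ht'⟩ := (hf.and_eventually self_mem_nhdsWithin).exists
        refine ⟨j, hj, ?_⟩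
        have h1 : t - a < 0 := sub_neg.mpr ht'
        by_contra! h
        nlinarith
      exact ⟨a, ha0, Or.inr ⟨j₁, j₂, hy₁, hy₂, hj₁.trans hj₂.symm, fun k => hj₁ ▸ hle a k⟩⟩
  · push Not at hpos
    obtain ⟨j₀, hj₀⟩ := hy
    obtain ⟨j, hj, hjmax⟩ := Finset.exists_max_image (Finset.univ.filter fun j => y j = 0) x
      ⟨j₀, by simp [le_antisymm (hpos j₀) hj₀]⟩
    simp only [Finset.mem_filter, Finset.mem_univ, true_and] at hj hjmax
    have hev : ∀ k, ∀ᶠ t : ℝ in atTop, x k + t * y k ≤ x j := by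
      intro k
      rcases (hpos k).lt_or_eq with h | h
      · have : Tendsto (fun t : ℝ => x k + t * y k) atTop atBot :=
          tendsto_atBot_add_const_left _ _ (tendsto_id.atTop_mul_const_of_neg h)
        exact this.eventually_le_atBot _
      · exact Eventually.of_forall fun t => by simpa [h] using hjmax k h
    obtain ⟨t, ht, ht0⟩ := ((eventually_all.mpr hev).and (eventually_ge_atTop 0)).exists
    exact ⟨t, ht0, Or.inl ⟨j, hj.ge, ht⟩⟩


/-! ### Path expectations and conditioning on the history. -/

namespace VendingMachine

variable {U X Y A M N R : Type*} [Fintype U] [Fintype Y]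
variable {d : ℕ}

theorem slide_last {U : Type*} (v : Fin (d + 1) → U) (u : U) : slide v u (Fin.last d) = u := by
  simp [slide]

theorem sum_snoc {α : Type*} [Fintype α] {i : ℕ} (F : (Fin (i + 1) → α) → ℝ) :
    ∑ w, F w = ∑ w : Fin i → α, ∑ a, F (Fin.snoc (α := fun _ => α) w a) := by
  rw [← (Fin.snocEquiv fun _ : Fin (i + 1) => α).sum_comp, Fintype.sum_prod_type_right]
  rfl

/-- The action, as a function of the next window, that the encoder takes after the history `w`. -/
def historyAction {U Y : Type*} (e : Encoder d U X Y M N) (i : ℕ) (s₀ : State d U M N) (w : Fin i → U × Y) :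
    (Fin (d + 1) → U) → X :=
  fun v => e i s₀ (Fin.snoc (α := fun _ => U) (fun j => (w j).1) (v (Fin.last d)))
    (fun j => (w j).2)

/-- `historyAction` reads only the last symbol of its window, so the window `v` before the shift is
arbitrary. -/
theorem encoded_snoc {U Y : Type*} (e : Encoder d U X Y M N) (i : ℕ) (s₀ : State d U M N) (w : Fin i → U × Y)
    (z : U × Y) (v : Fin (d + 1) → U) :
    encoded e i s₀ (Fin.snoc (α := fun _ => U × Y) w z) =
      historyAction e i s₀ w (slide v z.1) := by
  unfold encoded historyAction
  rw [slide_last]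
  congr 1
  · funext j
    refine Fin.lastCases ?_ (fun j => ?_) j <;> simp
  · funext j
    simp

variable (S : VendingMachine U X Y A M N R) (dec : Decoder X Y M N R) (act : Actuator X A M)

theorem source_nonneg (u : U) : 0 ≤ S.source u := S.source.2.1 u

theorem source_sum : ∑ u, S.source u = 1 := S.source.2.2

theorem channel_nonneg (u : U) (b : A) (y : Y) : 0 ≤ S.channel u b y := (S.channel u b).2.1 y

theorem channel_sum (u : U) (b : A) : ∑ y, S.channel u b y = 1 := (S.channel u b).2.2

variable {S act} in
theorem stepExp_mono {s : State d U M N} {a : (Fin (d + 1) → U) → X}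
    {φ ψ : (Fin (d + 1) → U) → X → Y → ℝ} (h : ∀ v x y, φ v x y ≤ ψ v x y) :
    S.stepExp act s a φ ≤ S.stepExp act s a ψ := by
  unfold stepExp
  gcongr with u _ y _
  · exact mul_nonneg (S.source_nonneg _) (S.channel_nonneg _ _ _)
  · exact h _ _ _

theorem stepExp_of_const_side (s : State d U M N) (a : (Fin (d + 1) → U) → X)
    (φ : (Fin (d + 1) → U) → X → ℝ) :
    S.stepExp act s a (fun v x _ => φ v x) =
      ∑ u, S.source u * φ (slide s.1 u) (a (slide s.1 u)) := by
  unfold stepExp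
  refine Finset.sum_congr rfl fun u _ => ?_
  simp_rw [mul_assoc, ← Finset.mul_sum, ← Finset.sum_mul, channel_sum, one_mul]

theorem stepExp_const (s : State d U M N) (a : (Fin (d + 1) → U) → X) (c : ℝ) :
    S.stepExp act s a (fun _ _ _ => c) = c := by
  rw [stepExp_of_const_side S act s a (fun _ _ => c), ← Finset.sum_mul, source_sum, one_mul]

/-- The conditional expectation, given the initial state, of a function of the history. -/
def pathExp (e : Encoder d U X Y M N) (i : ℕ) (s₀ : State d U M N) (φ : (Fin i → U × Y) → ℝ) : ℝ :=
  ∑ w, S.prob act e i s₀ w * φ w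

theorem prob_nonneg (e : Encoder d U X Y M N) (i : ℕ) (s₀ : State d U M N) (w : Fin i → U × Y) :
    0 ≤ S.prob act e i s₀ w := by
  induction i with
  | zero => exact zero_le_one
  | succ i ih =>
    exact mul_nonneg (ih _) (mul_nonneg (S.source_nonneg _) (S.channel_nonneg _ _ _))

variable {S act} in
theorem pathExp_mono {e : Encoder d U X Y M N} {i : ℕ} {s₀ : State d U M N}
    {φ ψ : (Fin i → U × Y) → ℝ} (h : ∀ w, φ w ≤ ψ w) :
    S.pathExp act e i s₀ φ ≤ S.pathExp act e i s₀ ψ :=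
  Finset.sum_le_sum fun w _ => mul_le_mul_of_nonneg_left (h w) (S.prob_nonneg act e i s₀ w)

theorem pathExp_add (e : Encoder d U X Y M N) (i : ℕ) (s₀ : State d U M N)
    (φ ψ : (Fin i → U × Y) → ℝ) :
    S.pathExp act e i s₀ (fun w => φ w + ψ w) =
      S.pathExp act e i s₀ φ + S.pathExp act e i s₀ ψ := by
  simp [pathExp, mul_add, Finset.sum_add_distrib]

theorem pathExp_const_mul (e : Encoder d U X Y M N) (i : ℕ) (s₀ : State d U M N) (c : ℝ)
    (φ : (Fin i → U × Y) → ℝ) :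
    S.pathExp act e i s₀ (fun w => c * φ w) = c * S.pathExp act e i s₀ φ := by
  simp [pathExp, Finset.mul_sum, mul_left_comm]

theorem state_succ_snoc (e : Encoder d U X Y M N) (i : ℕ) (s₀ : State d U M N)
    (w : Fin i → U × Y) (z : U × Y) :
    S.state e (i + 1) s₀ (Fin.snoc (α := fun _ => U × Y) w z) =
      (slide (S.state e i s₀ w).1 z.1,
        S.updM (S.state e i s₀ w).2.1
          (historyAction e i s₀ w (slide (S.state e i s₀ w).1 z.1)),
        S.updN (S.state e i s₀ w).2.2 z.2) := by
  rw [state, encoded_snoc e i s₀ w z (S.state e i s₀ w).1]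
  simp only [Fin.snoc_castSucc, Fin.snoc_last]

/-- Conditioning on the history before the last step. -/
theorem pathExp_succ (e : Encoder d U X Y M N) (i : ℕ) (s₀ : State d U M N)
    (φ : (Fin (i + 1) → U × Y) → ℝ)
    (ψ : (Fin i → U × Y) → (Fin (d + 1) → U) → X → Y → ℝ)
    (h : ∀ w z, φ (Fin.snoc (α := fun _ => U × Y) w z) =
      ψ w (slide (S.state e i s₀ w).1 z.1)
        (historyAction e i s₀ w (slide (S.state e i s₀ w).1 z.1)) z.2) :
    S.pathExp act e (i + 1) s₀ φ = S.pathExp act e i s₀ fun w =>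
      S.stepExp act (S.state e i s₀ w) (historyAction e i s₀ w) (ψ w) := by
  unfold pathExp
  rw [sum_snoc]
  refine Finset.sum_congr rfl fun w _ => ?_
  unfold stepExp
  rw [Fintype.sum_prod_type, Finset.mul_sum]
  refine Finset.sum_congr rfl fun u _ => ?_
  rw [Finset.mul_sum]
  refine Finset.sum_congr rfl fun y _ => ?_
  rw [h, prob, symbol, action, state_succ_snoc, encoded_snoc e i s₀ w _ (S.state e i s₀ w).1]
  simp only [Fin.snoc_castSucc, Fin.snoc_last]
  ring

theorem pathExp_one (e : Encoder d U X Y M N) (i : ℕ) (s₀ : State d U M N) :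
    S.pathExp act e i s₀ (fun _ => 1) = 1 := by
  induction i with
  | zero => simp [pathExp, prob]
  | succ i ih =>
    rw [pathExp_succ S act e i s₀ _ (fun _ _ _ _ => 1) (fun _ _ => rfl)]
    simpa only [stepExp_const] using ih

theorem pathExp_const (e : Encoder d U X Y M N) (i : ℕ) (s₀ : State d U M N) (c : ℝ) :
    S.pathExp act e i s₀ (fun _ => c) = c := by
  simpa [pathExp_one] using S.pathExp_const_mul act e i s₀ c (fun _ => 1)

theorem pathExp_state_succ (e : Encoder d U X Y M N) (i : ℕ) (s₀ : State d U M N)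
    (φ : State d U M N → ℝ) :
    S.pathExp act e (i + 1) s₀ (fun w => φ (S.state e (i + 1) s₀ w)) =
      S.pathExp act e i s₀ fun w =>
        S.nextExp act φ (S.state e i s₀ w) (historyAction e i s₀ w) :=
  S.pathExp_succ act e i s₀ _ _ fun w z => by rw [state_succ_snoc]

/-- The expected distortion of the next step. -/
def stageDistortion (s : State d U M N) (a : (Fin (d + 1) → U) → X) : ℝ :=
  S.stepExp act s a (fun v x y => S.distortion (v 0) (dec x y s.2.1 s.2.2))

/-- The expected cost of the next step. -/
def stageCost (s : State d U M N) (a : (Fin (d + 1) → U) → X) : ℝ :=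
  ∑ u : U, S.source u * S.cost (act s.2.1 (a (slide s.1 u)))

theorem lagrangianReward_eq (lam : ℝ) (s : State d U M N) (a : (Fin (d + 1) → U) → X) :
    S.lagrangianReward dec act lam s a =
      -S.stageDistortion dec act s a + lam * (S.budget - S.stageCost act s a) := rfl

theorem stageCost_eq_stepExp (s : State d U M N) (a : (Fin (d + 1) → U) → X) :
    S.stageCost act s a = S.stepExp act s a (fun _ x _ => S.cost (act s.2.1 x)) :=
  (S.stepExp_of_const_side act s a (fun _ x => S.cost (act s.2.1 x))).symm

variable [Fintype M] [Fintype N]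

theorem expDistortion_eq (ν : stdSimplex ℝ (State d U M N)) (e : Encoder d U X Y M N) (i : ℕ) :
    S.expDistortion dec act ν e i = ∑ s₀, ν s₀ * S.pathExp act e i s₀ fun w =>
      S.stageDistortion dec act (S.state e i s₀ w) (historyAction e i s₀ w) := by
  unfold expDistortion
  refine Finset.sum_congr rfl fun s₀ _ => ?_
  congr 1
  refine S.pathExp_succ act e i s₀ _ (fun w v x y => S.distortion (v 0)
    (dec x y (S.state e i s₀ w).2.1 (S.state e i s₀ w).2.2)) fun w z => ?_
  rw [symbol, reconstruction, state_succ_snoc, encoded_snoc e i s₀ w _ (S.state e i s₀ w).1]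
  simp only [Fin.snoc_castSucc, Fin.snoc_last]

theorem expCost_eq (ν : stdSimplex ℝ (State d U M N)) (e : Encoder d U X Y M N) (i : ℕ) :
    S.expCost act ν e i = ∑ s₀, ν s₀ * S.pathExp act e i s₀ fun w =>
      S.stageCost act (S.state e i s₀ w) (historyAction e i s₀ w) := by
  unfold expCost
  refine Finset.sum_congr rfl fun s₀ _ => ?_
  congr 1
  simp_rw [stageCost_eq_stepExp]
  refine S.pathExp_succ act e i s₀ _ (fun w _ x _ => S.cost (act (S.state e i s₀ w).2.1 x))
    fun w z => ?_
  rw [action, encoded_snoc e i s₀ w _ (S.state e i s₀ w).1]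
  simp only [Fin.snoc_castSucc]

end VendingMachine

/-! ### Weak duality. -/

namespace VendingMachine

variable {U X Y A M N R : Type*} [Fintype U] [Fintype Y]
variable {d : ℕ}
variable (S : VendingMachine U X Y A M N R) (dec : Decoder X Y M N R) (act : Actuator X A M)

theorem nextExp_mono {φ ψ : State d U M N → ℝ} (h : ∀ s, φ s ≤ ψ s) (s : State d U M N)
    (a : (Fin (d + 1) → U) → X) : S.nextExp act φ s a ≤ S.nextExp act ψ s a :=
  stepExp_mono fun _ _ _ => h _

theorem nextExp_const (c : ℝ) (s : State d U M N) (a : (Fin (d + 1) → U) → X) :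
    S.nextExp act (fun _ => c) s a = c :=
  S.stepExp_const act s a c

theorem nextExp_add (φ ψ : State d U M N → ℝ) (s : State d U M N) (a : (Fin (d + 1) → U) → X) :
    S.nextExp act (φ + ψ) s a = S.nextExp act φ s a + S.nextExp act ψ s a := by
  simp [nextExp, stepExp, mul_add, Finset.sum_add_distrib]

theorem nextExp_smul (c : ℝ) (φ : State d U M N → ℝ) (s : State d U M N)
    (a : (Fin (d + 1) → U) → X) :
    S.nextExp act (c • φ) s a = c * S.nextExp act φ s a := by
  simp [nextExp, stepExp, Finset.mul_sum, mul_left_comm]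

/-- Whatever the encoder does after a history is one of the actions in the maximum, so only the
upper-bound half of the optimality equation enters. -/
theorem pathExp_lagrangianReward_le {lam c : ℝ} {ρ h : State d U M N → ℝ}
    (hACOE : S.SolvesACOE dec act lam ρ h) (hc : ∀ s, ρ s ≤ c) (e : Encoder d U X Y M N) (i : ℕ)
    (s₀ : State d U M N) :
    S.pathExp act e i s₀ (fun w => S.lagrangianReward dec act lam (S.state e i s₀ w)
        (historyAction e i s₀ w)) + S.pathExp act e (i + 1) s₀ (fun w => h (S.state e (i + 1) s₀ w))
      ≤ c + S.pathExp act e i s₀ (fun w => h (S.state e i s₀ w)) := by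
  rw [pathExp_state_succ, ← pathExp_add, ← S.pathExp_const act e i s₀ c, ← pathExp_add]
  refine pathExp_mono fun w => ?_
  have := (hACOE (S.state e i s₀ w)).1.2 ⟨historyAction e i s₀ w, rfl⟩
  exact this.trans (by gcongr; exact hc _)

theorem pathExp_lagrangianReward (lam : ℝ) (e : Encoder d U X Y M N) (i : ℕ)
    (s₀ : State d U M N) :
    S.pathExp act e i s₀ (fun w => S.lagrangianReward dec act lam (S.state e i s₀ w)
        (historyAction e i s₀ w)) =
      -S.pathExp act e i s₀ (fun w =>
        S.stageDistortion dec act (S.state e i s₀ w) (historyAction e i s₀ w)) +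
      lam * (S.budget - S.pathExp act e i s₀ (fun w =>
        S.stageCost act (S.state e i s₀ w) (historyAction e i s₀ w))) := by
  simp_rw [lagrangianReward_eq]
  rw [← S.pathExp_const act e i s₀ S.budget]
  simp only [pathExp, Finset.mul_sum, ← Finset.sum_neg_distrib, ← Finset.sum_sub_distrib,
    ← Finset.sum_add_distrib]
  rw [show ∑ i_1, S.prob act e i s₀ i_1 * S.budget = S.budget from S.pathExp_const act e i s₀ _]
  refine Finset.sum_congr rfl fun w _ => ?_
  ring

variable [Fintype M] [Fintype N]

/-- The one-step bounds telescope in the expectation of `h`; the boundary terms are bounded because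
`h` takes finitely many values. -/
theorem lagrangian_sum_le {lam c : ℝ} {ρ h : State d U M N → ℝ}
    (hACOE : S.SolvesACOE dec act lam ρ h) (hc : ∀ s, ρ s ≤ c)
    (ν : stdSimplex ℝ (State d U M N)) (e : Encoder d U X Y M N) :
    ∃ B, ∀ K : ℕ, -∑ i ∈ Finset.range K, S.expDistortion dec act ν e i +
      lam * (K * S.budget - ∑ i ∈ Finset.range K, S.expCost act ν e i) ≤ K * c + B := by
  set H : ℕ → ℝ := fun i => ∑ s₀, ν s₀ * S.pathExp act e i s₀ (fun w => h (S.state e i s₀ w))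
    with hH
  have hstep : ∀ i, -S.expDistortion dec act ν e i + lam * (S.budget - S.expCost act ν e i)
      + H (i + 1) ≤ c + H i := by
    intro i
    have hν : ∀ b : ℝ, b = ∑ s₀, ν s₀ * b := fun b => by
      rw [← Finset.sum_mul, show ∑ s₀, ν s₀ = 1 from ν.2.2, one_mul]
    have key := Finset.sum_le_sum fun s₀ (_ : s₀ ∈ Finset.univ) => mul_le_mul_of_nonneg_left
      (S.pathExp_lagrangianReward_le dec act hACOE hc e i s₀) (ν.2.1 s₀)
    simp only [pathExp_lagrangianReward] at key
    rw [expDistortion_eq, expCost_eq, hH]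
    change ∑ s₀, ν s₀ * _ ≤ ∑ s₀, ν s₀ * _ at key
    simp only [mul_add, Finset.sum_add_distrib, mul_neg, Finset.sum_neg_distrib, mul_sub,
      Finset.sum_sub_distrib, mul_left_comm _ lam, ← Finset.mul_sum, ← hν] at key ⊢
    linarith [hν c, hν (lam * S.budget)]
  have hsum : ∀ K : ℕ, -∑ i ∈ Finset.range K, S.expDistortion dec act ν e i +
      lam * (K * S.budget - ∑ i ∈ Finset.range K, S.expCost act ν e i) + H K ≤ K * c + H 0 := by
    intro K
    induction K with
    | zero => simp
    | succ K ih =>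
      rw [Finset.sum_range_succ, Finset.sum_range_succ]
      push_cast
      linarith [hstep K]
  obtain ⟨b, hb⟩ : ∃ b, ∀ s, b ≤ h s := by
    obtain ⟨b, hb⟩ := (Set.finite_range h).bddBelow
    exact ⟨b, fun s => hb ⟨s, rfl⟩⟩
  have hHb : ∀ K, b ≤ H K := by
    intro K
    calc b = ∑ s₀, ν s₀ * b := by
          rw [← Finset.sum_mul, show ∑ s₀, ν s₀ = 1 from ν.2.2, one_mul]
      _ ≤ H K := Finset.sum_le_sum fun s₀ _ => mul_le_mul_of_nonneg_left (by
          rw [← S.pathExp_const act e K s₀ b]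
          exact pathExp_mono fun w => hb _) (ν.2.1 s₀)
  exact ⟨H 0 - b, fun K => by linarith [hsum K, hHb K]⟩

/-- Weak duality. -/
theorem neg_le_avgDistortion {lam c : ℝ} (hlam : 0 ≤ lam) {ρ h : State d U M N → ℝ}
    (hACOE : S.SolvesACOE dec act lam ρ h) (hc : ∀ s, ρ s ≤ c)
    (ν : stdSimplex ℝ (State d U M N)) (e : Encoder d U X Y M N)
    (hcost : S.avgCost act ν e ≤ (S.budget : EReal)) :
    ((-c : ℝ) : EReal) ≤ S.avgDistortion dec act ν e := by
  obtain ⟨B, hB⟩ := S.lagrangian_sum_le dec act hACOE hc ν e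
  by_contra! hlt
  obtain ⟨z, hz, hzc⟩ := EReal.lt_iff_exists_real_btwn.mp hlt
  refine absurd hz (not_lt.mpr ?_)
  have hzc' : 0 < -c - z := sub_pos.mpr (EReal.coe_lt_coe_iff.mp hzc)
  -- Half of the gap pays for the cost slack `lam * δ`, the other half for `B / K`; `lam + 1` keeps
  -- the denominator positive when `lam = 0`.
  set δ : ℝ := (-c - z) / (2 * (lam + 1)) with hδ
  have hδ0 : 0 < δ := by positivity
  have hδ1 : lam * δ ≤ (-c - z) / 2 := by
    rw [hδ, mul_div_assoc', div_le_div_iff₀ (by positivity) (by positivity)]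
    nlinarith
  have hev : ∀ᶠ K : ℕ in atTop, (1 / K : ℝ) * ∑ i ∈ Finset.range K, S.expCost act ν e i
      < S.budget + δ := by
    have : S.avgCost act ν e < ((S.budget + δ : ℝ) : EReal) :=
      hcost.trans_lt (EReal.coe_lt_coe_iff.mpr (by linarith))
    filter_upwards [eventually_lt_of_limsup_lt this] with K hK
    exact EReal.coe_lt_coe_iff.mp hK
  have hBK : ∀ᶠ K : ℕ in atTop, (1 / K : ℝ) * B < (-c - z) / 2 := by
    have : Tendsto (fun K : ℕ => (1 / K : ℝ) * B) atTop (nhds 0) := by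
      simpa using (tendsto_one_div_atTop_nhds_zero_nat (𝕜 := ℝ)).mul_const B
    exact this.eventually_lt_const (by linarith)
  refine le_limsup_of_frequently_le (Eventually.frequently ?_)
  filter_upwards [hev, hBK, eventually_gt_atTop 0] with K h1 h2 hK
  rw [EReal.coe_le_coe_iff]
  have hK0 : (0 : ℝ) < K := by exact_mod_cast hK
  have h3 := mul_le_mul_of_nonneg_left (hB K) (by positivity : (0 : ℝ) ≤ 1 / K)
  have h4 : (1 / K : ℝ) * K = 1 := by field_simp
  have h5 := mul_le_mul_of_nonneg_left h1.le hlam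
  set D := ∑ i ∈ Finset.range K, S.expDistortion dec act ν e i
  set C := ∑ i ∈ Finset.range K, S.expCost act ν e i
  have h6 : (1 / K : ℝ) * (-D + lam * (K * S.budget - C)) =
      -(1 / K * D) + lam * (((1 / K) * K) * S.budget - 1 / K * C) := by ring
  have h7 : (1 / K : ℝ) * (K * c + B) = ((1 / K) * K) * c + 1 / K * B := by ring
  rw [h6, h7, h4] at h3
  linarith

end VendingMachine

/-! ### Deterministic time sharing. -/

/-- A deterministic sequence of bits of prescribed density. -/
theorem exists_bits_of_density {θ : ℝ} (h0 : 0 ≤ θ) (h1 : θ ≤ 1) :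
    ∃ b : ℕ → Bool, ∀ p q : ℝ, Tendsto (fun K : ℕ =>
      (1 / K : ℝ) * ∑ i ∈ Finset.range K, if b i then p else q) atTop
        (nhds (θ * p + (1 - θ) * q)) := by
  -- The bit is set when `⌊θ * i⌋₊` jumps. As `θ ≤ 1` each jump is by one, so the first `K` bits
  -- contain exactly `⌊θ * K⌋₊` ones.
  refine ⟨fun i => decide (⌊θ * i⌋₊ < ⌊θ * (i + 1 : ℕ)⌋₊), fun p q => ?_⟩
  have hsum : ∀ K : ℕ, ∑ i ∈ Finset.range K,
      (if decide (⌊θ * i⌋₊ < ⌊θ * (i + 1 : ℕ)⌋₊) then p else q) =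
        K * q + (⌊θ * K⌋₊ : ℝ) * (p - q) := by
    intro K
    induction K with
    | zero => simp
    | succ K ih =>
      rw [Finset.sum_range_succ, ih]
      have hle : ⌊θ * K⌋₊ ≤ ⌊θ * (K + 1 : ℕ)⌋₊ := by
        gcongr
        simp
      have hge : ⌊θ * (K + 1 : ℕ)⌋₊ ≤ ⌊θ * K⌋₊ + 1 := by
        rw [← Nat.floor_add_one (by positivity)]
        gcongr
        push_cast
        linarith
      by_cases h : ⌊θ * K⌋₊ < ⌊θ * (K + 1 : ℕ)⌋₊
      · rw [le_antisymm hge h]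
        simp only [lt_add_iff_pos_right, zero_lt_one, decide_true, if_true]
        push_cast
        ring
      · rw [le_antisymm (not_lt.mp h) hle]
        simp only [lt_irrefl, decide_false, Bool.false_eq_true, if_false]
        push_cast
        ring
  have hlim : Tendsto (fun K : ℕ => (⌊θ * K⌋₊ : ℝ) / K) atTop (nhds θ) :=
    (tendsto_nat_floor_mul_div_atTop h0).comp tendsto_natCast_atTop_atTop
  have := (hlim.mul_const (p - q)).const_add q
  rw [show q + θ * (p - q) = θ * p + (1 - θ) * q by ring] at this
  refine this.congr' ?_
  filter_upwards [eventually_gt_atTop 0] with K hK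
  rw [hsum]
  have : (K : ℝ) ≠ 0 := by positivity
  field_simp

/-! ### Stationary policies, their long-run averages, and achievable distortions. -/

namespace VendingMachine

/-- A stationary deterministic encoding policy. -/
abbrev Policy (d : ℕ) (U X M N : Type*) : Type _ := State d U M N → (Fin (d + 1) → U) → X

section Encoder

variable {U X Y A M N R : Type*} [Fintype U] [Fintype Y]
variable {d : ℕ}
variable (S : VendingMachine U X Y A M N R) (dec : Decoder X Y M N R) (act : Actuator X A M)

/-- The state process under a policy that may depend on time and on the initial state. -/
def policyState (F : ℕ → State d U M N → Policy d U X M N) :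
    (i : ℕ) → State d U M N → (Fin i → U × Y) → State d U M N
  | 0, s₀, _ => s₀
  | i + 1, s₀, w =>
    let s := policyState F i s₀ (fun j => w j.castSucc)
    let v := slide s.1 (w (Fin.last i)).1
    (v, S.updM s.2.1 (F i s₀ s v), S.updN s.2.2 (w (Fin.last i)).2)

/-- The encoder that follows a policy. -/
def policyEncoder (F : ℕ → State d U M N → Policy d U X M N) : Encoder d U X Y M N :=
  fun i s₀ u y =>
    -- Feedback lets the encoder recompute the state from the first `i` symbol pairs; the newest
    -- source symbol enters only through the shifted window.
    let s := S.policyState F i s₀ (fun j => (u j.castSucc, y j))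
    F i s₀ s (slide s.1 (u (Fin.last i)))

theorem state_policyEncoder (F : ℕ → State d U M N → Policy d U X M N) (i : ℕ)
    (s₀ : State d U M N) (w : Fin i → U × Y) :
    S.state (S.policyEncoder F) i s₀ w = S.policyState F i s₀ w := by
  induction i with
  | zero => rfl
  | succ i ih =>
    rw [state, policyState]
    simp only [ih]
    rfl

/-- Agreement is claimed only on shifted windows, the only ones at which `stepExp` evaluates an
action. -/
theorem historyAction_policyEncoder (F : ℕ → State d U M N → Policy d U X M N) (i : ℕ)
    (s₀ : State d U M N) (w : Fin i → U × Y) (u : U) :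
    historyAction (S.policyEncoder F) i s₀ w (slide (S.state (S.policyEncoder F) i s₀ w).1 u) =
      F i s₀ (S.state (S.policyEncoder F) i s₀ w)
        (slide (S.state (S.policyEncoder F) i s₀ w).1 u) := by
  rw [state_policyEncoder]
  simp only [historyAction, policyEncoder, slide_last, Fin.snoc_castSucc, Fin.snoc_last]

variable {S act} in
theorem stepExp_congr {s : State d U M N} {a b : (Fin (d + 1) → U) → X}
    (h : ∀ u, a (slide s.1 u) = b (slide s.1 u)) (φ : (Fin (d + 1) → U) → X → Y → ℝ) :
    S.stepExp act s a φ = S.stepExp act s b φ := by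
  simp only [stepExp, h]

/-- The transition operator of a stationary policy. -/
def transition (f : Policy d U X M N) : (State d U M N → ℝ) →ₗ[ℝ] (State d U M N → ℝ) where
  toFun φ s := S.nextExp act φ s (f s)
  map_add' φ ψ := funext fun s => S.nextExp_add act φ ψ s (f s)
  map_smul' c φ := funext fun s => S.nextExp_smul act c φ s (f s)

theorem transition_apply (f : Policy d U X M N) (φ : State d U M N → ℝ) (s : State d U M N) :
    S.transition act f φ s = S.nextExp act φ s (f s) := rfl

theorem transition_const (f : Policy d U X M N) (c : ℝ) :
    S.transition act f (fun _ => c) = fun _ => c :=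
  funext fun s => S.nextExp_const act c s (f s)

theorem pathExp_policyEncoder_succ (F : ℕ → State d U M N → Policy d U X M N) (i : ℕ)
    (s₀ : State d U M N) (φ : State d U M N → ℝ) :
    S.pathExp act (S.policyEncoder F) (i + 1) s₀
        (fun w => φ (S.state (S.policyEncoder F) (i + 1) s₀ w)) =
      S.pathExp act (S.policyEncoder F) i s₀
        (fun w => S.transition act (F i s₀) φ (S.state (S.policyEncoder F) i s₀ w)) := by
  rw [pathExp_state_succ]
  congr 1
  funext w
  exact stepExp_congr (S.historyAction_policyEncoder F i s₀ w) _

theorem pathExp_policyEncoder (f : State d U M N → Policy d U X M N) (i : ℕ)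
    (s₀ : State d U M N) (φ : State d U M N → ℝ) :
    S.pathExp act (S.policyEncoder fun _ => f) i s₀
        (fun w => φ (S.state (S.policyEncoder fun _ => f) i s₀ w)) =
      (S.transition act (f s₀) ^ i) φ s₀ := by
  induction i generalizing φ with
  | zero => simp [pathExp, prob, state]
  | succ i ih =>
    rw [pathExp_policyEncoder_succ, ih, pow_succ, Module.End.mul_apply]

theorem pathExp_policyEncoder_of_absorbing (F : ℕ → State d U M N → Policy d U X M N)
    (s : State d U M N) (hs : ∀ i φ, S.transition act (F i s) φ s = φ s) (i : ℕ)
    (φ : State d U M N → ℝ) :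
    S.pathExp act (S.policyEncoder F) i s (fun w => φ (S.state (S.policyEncoder F) i s w)) =
      φ s := by
  induction i generalizing φ with
  | zero => simp [pathExp, prob, state]
  | succ i ih => rw [pathExp_policyEncoder_succ, ih, hs]

/-- The expected distortion of the next step under a stationary policy. -/
def policyDistortion (f : Policy d U X M N) (s : State d U M N) : ℝ :=
  S.stageDistortion dec act s (f s)

/-- The expected cost of the next step under a stationary policy. -/
def policyCost (f : Policy d U X M N) (s : State d U M N) : ℝ :=
  S.stageCost act s (f s)

variable [Fintype M] [Fintype N]

theorem expDistortion_policyEncoder (F : ℕ → State d U M N → Policy d U X M N)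
    (ν : stdSimplex ℝ (State d U M N)) (i : ℕ) :
    S.expDistortion dec act ν (S.policyEncoder F) i =
      ∑ s₀, ν s₀ * S.pathExp act (S.policyEncoder F) i s₀ fun w =>
        S.policyDistortion dec act (F i s₀) (S.state (S.policyEncoder F) i s₀ w) := by
  rw [expDistortion_eq]
  refine Finset.sum_congr rfl fun s₀ _ => ?_
  congr 2
  funext w
  exact stepExp_congr (S.historyAction_policyEncoder F i s₀ w) _

theorem expCost_policyEncoder (F : ℕ → State d U M N → Policy d U X M N)
    (ν : stdSimplex ℝ (State d U M N)) (i : ℕ) :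
    S.expCost act ν (S.policyEncoder F) i =
      ∑ s₀, ν s₀ * S.pathExp act (S.policyEncoder F) i s₀ fun w =>
        S.policyCost act (F i s₀) (S.state (S.policyEncoder F) i s₀ w) := by
  rw [expCost_eq]
  refine Finset.sum_congr rfl fun s₀ _ => ?_
  congr 2
  funext w
  simp only [policyCost, stageCost_eq_stepExp]
  exact stepExp_congr (S.historyAction_policyEncoder F i s₀ w) _

/-- The operator averages against a probability kernel, hence is a sup-norm contraction; this is
what the ergodic theorem needs. -/
theorem norm_transition_le (f : Policy d U X M N) (φ : State d U M N → ℝ) :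
    ‖S.transition act f φ‖ ≤ ‖φ‖ := by
  rw [pi_norm_le_iff_of_nonneg (norm_nonneg φ)]
  intro s
  rw [Real.norm_eq_abs, abs_le, transition_apply]
  have hb : ∀ t, -‖φ‖ ≤ φ t ∧ φ t ≤ ‖φ‖ := fun t => abs_le.mp (norm_le_pi_norm φ t)
  constructor
  · rw [← S.nextExp_const act (-‖φ‖) s (f s)]
    exact S.nextExp_mono act (fun t => (hb t).1) s (f s)
  · rw [← S.nextExp_const act ‖φ‖ s (f s)]
    exact S.nextExp_mono act (fun t => (hb t).2) s (f s)

/-- The long-run average of `φ` under a stationary policy, as a function of the initial state. -/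
def longRun (f : Policy d U X M N) (φ : State d U M N → ℝ) : State d U M N → ℝ :=
  (exists_fixed_tendsto_cesaro (S.transition act f) (S.norm_transition_le act f) φ).choose

theorem transition_longRun (f : Policy d U X M N) (φ : State d U M N → ℝ) :
    S.transition act f (S.longRun act f φ) = S.longRun act f φ :=
  (exists_fixed_tendsto_cesaro (S.transition act f) (S.norm_transition_le act f) φ).choose_spec.1

theorem tendsto_longRun (f : Policy d U X M N) (φ : State d U M N → ℝ) (s : State d U M N) :
    Tendsto (fun K : ℕ => (1 / K : ℝ) * ∑ i ∈ Finset.range K, (S.transition act f ^ i) φ s) atTop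
      (nhds (S.longRun act f φ s)) :=
  (exists_fixed_tendsto_cesaro (S.transition act f) (S.norm_transition_le act f) φ).choose_spec.2 s

variable {S act} in
theorem longRun_unique {f : Policy d U X M N} {φ : State d U M N → ℝ} {s : State d U M N} {c : ℝ}
    (h : Tendsto (fun K : ℕ => (1 / K : ℝ) * ∑ i ∈ Finset.range K, (S.transition act f ^ i) φ s)
      atTop (nhds c)) : S.longRun act f φ s = c :=
  tendsto_nhds_unique (S.tendsto_longRun act f φ s) h

theorem longRun_add (f : Policy d U X M N) (φ ψ : State d U M N → ℝ) :
    S.longRun act f (φ + ψ) = S.longRun act f φ + S.longRun act f ψ := by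
  funext s
  refine longRun_unique ?_
  refine ((S.tendsto_longRun act f φ s).add (S.tendsto_longRun act f ψ s)).congr fun K => ?_
  simp [Finset.sum_add_distrib, mul_add]

theorem longRun_smul (f : Policy d U X M N) (c : ℝ) (φ : State d U M N → ℝ) :
    S.longRun act f (c • φ) = c • S.longRun act f φ := by
  funext s
  refine longRun_unique ?_
  refine ((S.tendsto_longRun act f φ s).const_mul c).congr fun K => ?_
  simp [← Finset.mul_sum, mul_left_comm]

theorem longRun_of_fixed_at {f : Policy d U X M N} {φ : State d U M N → ℝ} {s : State d U M N}
    (h : ∀ i : ℕ, (S.transition act f ^ i) φ s = φ s) : S.longRun act f φ s = φ s := by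
  refine longRun_unique (tendsto_const_nhds.congr' ?_)
  filter_upwards [eventually_gt_atTop 0] with K hK
  have : (K : ℝ) ≠ 0 := by positivity
  simp [h, this]

theorem longRun_of_fixed {f : Policy d U X M N} {φ : State d U M N → ℝ}
    (h : S.transition act f φ = φ) : S.longRun act f φ = φ := by
  funext s
  refine S.longRun_of_fixed_at act fun i => ?_
  suffices (S.transition act f ^ i) φ = φ by rw [this]
  induction i with
  | zero => rfl
  | succ i ih => rw [pow_succ, Module.End.mul_apply, h, ih]

/-- The difference telescopes to a bounded boundary term. This is what removes `h` from the
optimality equation. -/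
theorem longRun_transition (f : Policy d U X M N) (φ : State d U M N → ℝ) :
    S.longRun act f (S.transition act f φ) = S.longRun act f φ := by
  funext s
  refine longRun_unique ?_
  have hbd : Tendsto (fun K : ℕ => (1 / K : ℝ) * ((S.transition act f ^ K) φ s - φ s)) atTop
      (nhds 0) := by
    have hpow : ∀ K : ℕ, ‖(S.transition act f ^ K) φ‖ ≤ ‖φ‖ := by
      intro n
      induction n with
      | zero => simp
      | succ n ih =>
        rw [pow_succ']
        exact (S.norm_transition_le act f _).trans ih
    refine tendsto_one_div_atTop_nhds_zero_nat.zero_mul_isBoundedUnder_le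
      (isBoundedUnder_of ⟨‖φ‖ + ‖φ‖, fun K => ?_⟩)
    exact (norm_sub_le _ _).trans
      (add_le_add ((norm_le_pi_norm _ s).trans (hpow K)) (norm_le_pi_norm φ s))
  have := (S.tendsto_longRun act f φ s).add hbd
  rw [add_zero] at this
  refine this.congr fun K => ?_
  rw [← mul_add]
  congr 1
  have htel := Finset.sum_range_sub (fun i => (S.transition act f ^ i) φ s) K
  simp only [pow_zero, Module.End.one_apply] at htel
  rw [← htel, ← Finset.sum_add_distrib]
  refine Finset.sum_congr rfl fun i _ => ?_
  rw [pow_succ, Module.End.mul_apply]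
  ring

/-- The long-run average distortion of a stationary policy. -/
def longRunDistortion (f : Policy d U X M N) : State d U M N → ℝ :=
  S.longRun act f (S.policyDistortion dec act f)

/-- The long-run average cost of a stationary policy. -/
def longRunCost (f : Policy d U X M N) : State d U M N → ℝ :=
  S.longRun act f (S.policyCost act f)

/-- A solution of the optimality equation is the gain of a stationary policy. -/
theorem exists_policy_gain_eq {lam : ℝ} {ρ h : State d U M N → ℝ}
    (hACOE : S.SolvesACOE dec act lam ρ h) :
    ∃ f : Policy d U X M N, ∀ s,
      -S.longRunDistortion dec act f s + lam * (S.budget - S.longRunCost act f s) = ρ s := by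
  choose f hf hρ using fun s => (hACOE s).2
  refine ⟨f, fun s => ?_⟩
  have hTρ : S.transition act f ρ = ρ := funext hρ
  -- The optimality equation as an identity of functions: under `longRun` the two `h` terms cancel
  -- and `ρ`, being harmonic, is unchanged.
  have heq : (-1 : ℝ) • S.policyDistortion dec act f +
      lam • ((fun _ => S.budget) + (-1 : ℝ) • S.policyCost act f) + S.transition act f h
        = ρ + h := by
    funext t
    simp only [Pi.add_apply, Pi.smul_apply, smul_eq_mul, ← hf t, lagrangianReward_eq,
      transition_apply, policyDistortion, policyCost]
    ring
  have := congrArg (fun φ => S.longRun act f φ s) heq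
  simp only [longRun_add, longRun_smul, longRun_transition, S.longRun_of_fixed act hTρ,
    S.longRun_of_fixed act (S.transition_const act f S.budget), Pi.add_apply, Pi.smul_apply,
    smul_eq_mul] at this
  rw [longRunDistortion, longRunCost]
  linarith

theorem encoderOptimalDistortion_le {ν : stdSimplex ℝ (State d U M N)} {e : Encoder d U X Y M N}
    {D C : ℝ}
    (hD : Tendsto (fun K : ℕ => (1 / K : ℝ) * ∑ i ∈ Finset.range K, S.expDistortion dec act ν e i)
      atTop (nhds D))
    (hC : Tendsto (fun K : ℕ => (1 / K : ℝ) * ∑ i ∈ Finset.range K, S.expCost act ν e i)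
      atTop (nhds C)) (hCb : C ≤ S.budget) :
    S.encoderOptimalDistortion d dec act ≤ (D : EReal) := by
  have h1 : S.avgDistortion dec act ν e = (D : EReal) :=
    ((continuous_coe_real_ereal.tendsto D).comp hD).limsup_eq
  have h2 : S.avgCost act ν e = (C : EReal) :=
    ((continuous_coe_real_ereal.tendsto C).comp hC).limsup_eq
  rw [← h1]
  exact iInf_le_of_le ν (iInf_le_of_le e
    (iInf_le_of_le (h2 ▸ EReal.coe_le_coe_iff.mpr hCb) le_rfl))

/-- The encoder knows `S_0`, so it may run a different stationary policy from each initial state;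
the law `ν` then supplies the randomization. -/
theorem encoderOptimalDistortion_le_mixture (f : State d U M N → Policy d U X M N)
    (ν : stdSimplex ℝ (State d U M N))
    (hcost : ∑ s, ν s * S.longRunCost act (f s) s ≤ S.budget) :
    S.encoderOptimalDistortion d dec act ≤
      ((∑ s, ν s * S.longRunDistortion dec act (f s) s : ℝ) : EReal) := by
  have key : ∀ φ : Policy d U X M N → State d U M N → ℝ, Tendsto (fun K : ℕ => (1 / K : ℝ) *
      ∑ i ∈ Finset.range K, ∑ s, ν s * (S.transition act (f s) ^ i) (φ (f s)) s) atTop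
        (nhds (∑ s, ν s * S.longRun act (f s) (φ (f s)) s)) := by
    intro φ
    have := tendsto_finsetSum Finset.univ fun s _ =>
      (S.tendsto_longRun act (f s) (φ (f s)) s).const_mul (ν s)
    refine this.congr fun K => ?_
    rw [Finset.sum_comm, Finset.mul_sum]
    refine Finset.sum_congr rfl fun s _ => ?_
    rw [← Finset.mul_sum]
    ring
  refine S.encoderOptimalDistortion_le dec act (ν := ν) (e := S.policyEncoder fun _ => f)
    ((key (S.policyDistortion dec act)).congr fun K => ?_)
    ((key (S.policyCost act)).congr fun K => ?_) hcost
  · simp only [expDistortion_policyEncoder, pathExp_policyEncoder]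
  · simp only [expCost_policyEncoder, pathExp_policyEncoder]

/-- Time sharing between two policies that stay at the same state. -/
theorem encoderOptimalDistortion_le_of_absorbing {f₁ f₂ : Policy d U X M N} {s : State d U M N}
    (h₁ : ∀ φ, S.transition act f₁ φ s = φ s) (h₂ : ∀ φ, S.transition act f₂ φ s = φ s)
    {θ : ℝ} (hθ0 : 0 ≤ θ) (hθ1 : θ ≤ 1)
    (hcost : θ * S.longRunCost act f₁ s + (1 - θ) * S.longRunCost act f₂ s ≤ S.budget) :
    S.encoderOptimalDistortion d dec act ≤ ((θ * S.longRunDistortion dec act f₁ s +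
      (1 - θ) * S.longRunDistortion dec act f₂ s : ℝ) : EReal) := by
  classical
  have hstay : ∀ {f : Policy d U X M N}, (∀ φ, S.transition act f φ s = φ s) →
      ∀ φ, S.longRun act f φ s = φ s := by
    intro f hf φ
    refine S.longRun_of_fixed_at act fun i => ?_
    induction i with
    | zero => rfl
    | succ i ih => rw [pow_succ', Module.End.mul_apply, hf, ih]
  simp only [longRunCost, longRunDistortion, hstay h₁, hstay h₂] at hcost ⊢
  obtain ⟨b, hb⟩ := exists_bits_of_density hθ0 hθ1
  -- The chain never leaves `s`, so switching policies costs nothing and the averages are those of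
  -- the bit sequence.
  set F : ℕ → State d U M N → Policy d U X M N := fun i _ => if b i then f₁ else f₂ with hF
  have hFs : ∀ i φ, S.transition act (F i s) φ s = φ s := by
    intro i φ
    simp only [hF]
    split_ifs
    exacts [h₁ φ, h₂ φ]
  have hν : ∀ g : State d U M N → ℝ,
      ∑ s₀, (stdSimplex.vertex (S := ℝ) s) s₀ * g s₀ = g s := by
    intro g
    simp [Pi.single_apply]
  refine S.encoderOptimalDistortion_le dec act (ν := stdSimplex.vertex s)
    (e := S.policyEncoder F)
    ((hb (S.policyDistortion dec act f₁ s) (S.policyDistortion dec act f₂ s)).congr fun K => ?_)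
    ((hb (S.policyCost act f₁ s) (S.policyCost act f₂ s)).congr fun K => ?_) hcost
  · congr 1
    refine Finset.sum_congr rfl fun i _ => ?_
    rw [expDistortion_policyEncoder, hν, S.pathExp_policyEncoder_of_absorbing act F s hFs]
    simp only [hF]
    split_ifs <;> rfl
  · congr 1
    refine Finset.sum_congr rfl fun i _ => ?_
    rw [expCost_policyEncoder, hν, S.pathExp_policyEncoder_of_absorbing act F s hFs]
    simp only [hF]
    split_ifs <;> rfl

end Encoder
end VendingMachine

/-! ### Mixing at a saddle point, and strong duality. -/

namespace VendingMachine

variable {U X Y A M N R : Type*} [Fintype U] [Fintype Y] [Fintype M] [Fintype N]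
variable {d : ℕ}
variable (S : VendingMachine U X Y A M N R) (dec : Decoder X Y M N R) (act : Actuator X A M)

theorem encoderOptimalDistortion_le_single {f : Policy d U X M N} {s : State d U M N}
    (hcost : S.longRunCost act f s ≤ S.budget) :
    S.encoderOptimalDistortion d dec act ≤ ((S.longRunDistortion dec act f s : ℝ) : EReal) := by
  classical
  have hν : ∀ g : State d U M N → ℝ,
      ∑ s₀, (stdSimplex.vertex (S := ℝ) s) s₀ * g s₀ = g s := by
    intro g
    simp [Pi.single_apply]
  have := S.encoderOptimalDistortion_le_mixture dec act (fun _ => f) (stdSimplex.vertex s)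
  simpa only [hν (S.longRunCost act f), hν (S.longRunDistortion dec act f), hcost,
    true_implies] using this

/-- Mixing two policies through the law of the initial state. -/
theorem encoderOptimalDistortion_le_of_ne {f₁ f₂ : Policy d U X M N} {s₁ s₂ : State d U M N}
    (hne : s₁ ≠ s₂) {θ : ℝ} (hθ0 : 0 ≤ θ) (hθ1 : θ ≤ 1)
    (hcost : θ * S.longRunCost act f₁ s₁ + (1 - θ) * S.longRunCost act f₂ s₂ ≤ S.budget) :
    S.encoderOptimalDistortion d dec act ≤ ((θ * S.longRunDistortion dec act f₁ s₁ +
      (1 - θ) * S.longRunDistortion dec act f₂ s₂ : ℝ) : EReal) := by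
  classical
  let w : State d U M N → ℝ := fun s =>
    θ * (if s = s₁ then 1 else 0) + (1 - θ) * (if s = s₂ then 1 else 0)
  have hw : ∀ g : State d U M N → ℝ, ∑ s, w s * g s = θ * g s₁ + (1 - θ) * g s₂ := by
    intro g
    simp [w, add_mul, Finset.sum_add_distrib]
  let ν : stdSimplex ℝ (State d U M N) := ⟨w, fun s => by
    have := sub_nonneg.mpr hθ1
    simp only [w]
    positivity, by simpa using hw fun _ => 1⟩
  have hν : ∀ g : State d U M N → ℝ, ∑ s, ν s * g s = θ * g s₁ + (1 - θ) * g s₂ := hw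
  have := S.encoderOptimalDistortion_le_mixture dec act (fun s => if s = s₁ then f₁ else f₂) ν
  rw [hν, hν] at this
  simp only [if_true, hne.symm, if_false] at this
  exact this hcost

/-- From a maximizer of a harmonic function, only maximizers are reached. -/
theorem transition_apply_of_isMax {f : Policy d U X M N} {L : State d U M N → ℝ}
    (hL : S.transition act f L = L) {s : State d U M N} (hmax : ∀ t, L t ≤ L s)
    (honly : ∀ t, L t = L s → t = s) (φ : State d U M N → ℝ) :
    S.transition act f φ s = φ s := by
  -- As `s` is the only maximizer of `L` among finitely many states, `φ` lies between `φ s ± B * (L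
  -- s - L)`. Both bounds are affine in the harmonic `L`, so the operator keeps their value `φ s` at
  -- `s`.
  have hle : ∃ B : ℝ, 0 ≤ B ∧ ∀ t, |φ t - φ s| ≤ B * (L s - L t) := by
    have hpt : ∀ t, ∃ B : ℝ, 0 ≤ B ∧ |φ t - φ s| ≤ B * (L s - L t) := by
      intro t
      rcases (hmax t).lt_or_eq with hlt | heq
      · have hpos := sub_pos.mpr hlt
        exact ⟨|φ t - φ s| / (L s - L t), by positivity, by field_simp; rfl⟩
      · exact ⟨0, le_rfl, by simp [honly t heq]⟩
    choose B hB0 hB using hpt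
    refine ⟨∑ t, B t, Finset.sum_nonneg fun t _ => hB0 t, fun t => (hB t).trans ?_⟩
    have := Finset.single_le_sum (f := B) (fun t _ => hB0 t) (Finset.mem_univ t)
    exact mul_le_mul_of_nonneg_right this (sub_nonneg.mpr (hmax t))
  obtain ⟨B, -, hB⟩ := hle
  have hlin : ∀ c : ℝ, S.transition act f ((fun _ => φ s + c * L s) + (-c) • L) s = φ s := by
    intro c
    rw [map_add, map_smul, hL, transition_const]
    simp
  apply le_antisymm
  · rw [← hlin B]
    refine S.nextExp_mono act (fun t => ?_) s (f s)
    have := (abs_le.mp (hB t)).2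
    simp only [Pi.add_apply, Pi.smul_apply, smul_eq_mul]
    linarith
  · nth_rewrite 1 [← hlin (-B)]
    refine S.nextExp_mono act (fun t => ?_) s (f s)
    have := (abs_le.mp (hB t)).1
    simp only [Pi.add_apply, Pi.smul_apply, smul_eq_mul]
    linarith

/-- The constrained optimum is at least as good as any Lagrangian saddle value. -/
theorem encoderOptimalDistortion_le_of_saddle {a r : ℝ} (f₁ f₂ : Policy d U X M N)
    (s₁ s₂ : State d U M N)
    (hmax : ∀ (f : Policy d U X M N) s,
      -S.longRunDistortion dec act f s + a * (S.budget - S.longRunCost act f s) ≤ r)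
    (h₁ : -S.longRunDistortion dec act f₁ s₁ + a * (S.budget - S.longRunCost act f₁ s₁) = r)
    (h₂ : -S.longRunDistortion dec act f₂ s₂ + a * (S.budget - S.longRunCost act f₂ s₂) = r)
    (hc₁ : S.longRunCost act f₁ s₁ ≤ S.budget) (hc₂ : S.budget ≤ S.longRunCost act f₂ s₂) :
    S.encoderOptimalDistortion d dec act ≤ ((-r : ℝ) : EReal) := by
  have hθ : ∀ {c₁ c₂ : ℝ}, c₁ ≤ S.budget → S.budget ≤ c₂ →
      ∃ θ : ℝ, 0 ≤ θ ∧ θ ≤ 1 ∧ θ * c₁ + (1 - θ) * c₂ = S.budget := by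
    intro c₁ c₂ h h'
    have hmem : S.budget ∈ segment ℝ c₁ c₂ := by
      rw [segment_eq_Icc (h.trans h')]
      exact ⟨h, h'⟩
    obtain ⟨p, q, hp, hq, hpq, hb⟩ := hmem
    exact ⟨p, hp, by linarith, by rw [← hb, ← hpq]; simp⟩
  -- When the mixed cost equals the budget, the multiplier term vanishes from the mixed Lagrangian.
  have hval : ∀ {θ D₁ D₂ C₁ C₂ : ℝ}, -D₁ + a * (S.budget - C₁) = r →
      -D₂ + a * (S.budget - C₂) = r → θ * C₁ + (1 - θ) * C₂ = S.budget →
      θ * D₁ + (1 - θ) * D₂ = -r := by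
    intro θ D₁ D₂ C₁ C₂ e₁ e₂ e₃
    linear_combination -θ * e₁ - (1 - θ) * e₂ - a * e₃
  by_cases hex : ∃ (g₁ g₂ : Policy d U X M N) (t₁ t₂ : State d U M N), t₁ ≠ t₂ ∧
      -S.longRunDistortion dec act g₁ t₁ + a * (S.budget - S.longRunCost act g₁ t₁) = r ∧
      -S.longRunDistortion dec act g₂ t₂ + a * (S.budget - S.longRunCost act g₂ t₂) = r ∧
      S.longRunCost act g₁ t₁ ≤ S.budget ∧ S.budget ≤ S.longRunCost act g₂ t₂
  · obtain ⟨g₁, g₂, t₁, t₂, hne, e₁, e₂, k₁, k₂⟩ := hex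
    obtain ⟨θ, hθ0, hθ1, hθc⟩ := hθ k₁ k₂
    rw [← hval e₁ e₂ hθc]
    exact S.encoderOptimalDistortion_le_of_ne dec act hne hθ0 hθ1 hθc.le
  · obtain rfl : s₁ = s₂ := by
      by_contra hne
      exact hex ⟨f₁, f₂, s₁, s₂, hne, h₁, h₂, hc₁, hc₂⟩
    -- A second maximizer `t` of the gain of `f` has a cost on one side of the budget, so it pairs
    -- with `f₂` or `f₁` at `s₁`, giving the distinct states excluded here.
    have hstay : ∀ f : Policy d U X M N,
        -S.longRunDistortion dec act f s₁ + a * (S.budget - S.longRunCost act f s₁) = r →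
        ∀ φ, S.transition act f φ s₁ = φ s₁ := by
      intro f hf
      set L : State d U M N → ℝ := (-1 : ℝ) • S.longRunDistortion dec act f +
        a • ((fun _ => S.budget) + (-1 : ℝ) • S.longRunCost act f) with hLdef
      have hLt : ∀ t, L t =
          -S.longRunDistortion dec act f t + a * (S.budget - S.longRunCost act f t) := by
        intro t
        simp only [hLdef, Pi.add_apply, Pi.smul_apply, smul_eq_mul]
        ring
      have hL : S.transition act f L = L := by
        simp only [hLdef, map_add, map_smul, transition_const, longRunDistortion, longRunCost,
          transition_longRun]
      have hLs : L s₁ = r := (hLt s₁).trans hf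
      refine S.transition_apply_of_isMax act hL (fun t => ?_) fun t ht => ?_
      · rw [hLs, hLt]
        exact hmax f t
      · by_contra hne
        rw [hLs, hLt] at ht
        rcases le_total (S.longRunCost act f t) S.budget with h | h
        · exact hex ⟨f, f₂, t, s₁, hne, ht, h₂, h, hc₂⟩
        · exact hex ⟨f₁, f, s₁, t, Ne.symm hne, h₁, ht, hc₁, h⟩
    obtain ⟨θ, hθ0, hθ1, hθc⟩ := hθ hc₁ hc₂
    rw [← hval h₁ h₂ hθc]
    exact S.encoderOptimalDistortion_le_of_absorbing dec act (hstay f₁ h₁) (hstay f₂ h₂)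
      hθ0 hθ1 hθc.le

/-- Strong duality. -/
theorem encoderOptimalDistortion_le_neg_iInf [Finite X] [Nonempty (State d U M N)]
    {ρ h : ℝ → State d U M N → ℝ}
    (hACOE : ∀ lam : ℝ, 0 ≤ lam → S.SolvesACOE dec act lam (ρ lam) (h lam)) :
    S.encoderOptimalDistortion d dec act ≤
      -(⨅ (lam : ℝ) (_ : 0 ≤ lam), ⨆ s : State d U M N, (ρ lam s : EReal)) := by
  have hgain : ∀ lam : ℝ, 0 ≤ lam → ∀ s, ∃ f : Policy d U X M N,
      -S.longRunDistortion dec act f s + lam * (S.budget - S.longRunCost act f s) = ρ lam s := by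
    intro lam hlam s
    obtain ⟨f, hf⟩ := S.exists_policy_gain_eq dec act (hACOE lam hlam)
    exact ⟨f, hf s⟩
  have hinf : ∀ lam z : ℝ, 0 ≤ lam → (∀ s, ρ lam s ≤ z) →
      (⨅ (lam : ℝ) (_ : 0 ≤ lam), ⨆ s : State d U M N, (ρ lam s : EReal)) ≤ (z : EReal) :=
    fun lam z hlam hz => iInf₂_le_of_le lam hlam
      (iSup_le fun s => EReal.coe_le_coe_iff.mpr (hz s))
  by_cases hfeas : ∃ j : Policy d U X M N × State d U M N,
      0 ≤ S.budget - S.longRunCost act j.1 j.2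
  · obtain ⟨a, ha, hcase⟩ := exists_multiplier
      (fun j : Policy d U X M N × State d U M N => -S.longRunDistortion dec act j.1 j.2)
      (fun j => S.budget - S.longRunCost act j.1 j.2) hfeas
    rcases hcase with ⟨j, hj, hmax⟩ | ⟨j₁, j₂, hj₁, hj₂, heq, hmax⟩
    · refine (S.encoderOptimalDistortion_le_single dec act (sub_nonneg.mp hj)).trans ?_
      rw [EReal.le_neg, ← EReal.coe_neg]
      refine hinf a _ ha fun s => ?_
      obtain ⟨f, hf⟩ := hgain a ha s
      exact hf ▸ hmax (f, s)
    · refine (S.encoderOptimalDistortion_le_of_saddle dec act j₁.1 j₂.1 j₁.2 j₂.2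
        (fun f s => hmax (f, s)) rfl heq.symm (sub_nonneg.mp hj₁) (sub_nonpos.mp hj₂)).trans ?_
      rw [EReal.le_neg, ← EReal.coe_neg, neg_neg]
      refine hinf a _ ha fun s => ?_
      obtain ⟨f, hf⟩ := hgain a ha s
      exact hf ▸ hmax (f, s)
  -- Every line has negative slope, so the dual value is `⊥` and the bound is trivial.
  · push Not at hfeas
    suffices hbot :
        (⨅ (lam : ℝ) (_ : 0 ≤ lam), ⨆ s : State d U M N, (ρ lam s : EReal)) = ⊥ by
      rw [hbot, EReal.neg_bot]
      exact le_top
    rw [EReal.eq_bot_iff_forall_lt]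
    intro z
    have hev : ∀ j : Policy d U X M N × State d U M N, ∀ᶠ t : ℝ in atTop,
        -S.longRunDistortion dec act j.1 j.2 + t * (S.budget - S.longRunCost act j.1 j.2)
          ≤ z - 1 := fun j =>
      (tendsto_atBot_add_const_left _ _
        (tendsto_id.atTop_mul_const_of_neg (hfeas j))).eventually_le_atBot _
    obtain ⟨t, ht, ht0⟩ := ((eventually_all.mpr hev).and (eventually_ge_atTop 0)).exists
    refine (hinf t (z - 1) ht0 fun s => ?_).trans_lt (EReal.coe_lt_coe_iff.mpr (by linarith))
    obtain ⟨f, hf⟩ := hgain t ht0 s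
    exact hf ▸ ht (f, s)

theorem neg_iInf_le_encoderOptimalDistortion [Nonempty (State d U M N)]
    {ρ h : ℝ → State d U M N → ℝ}
    (hACOE : ∀ lam : ℝ, 0 ≤ lam → S.SolvesACOE dec act lam (ρ lam) (h lam)) :
    -(⨅ (lam : ℝ) (_ : 0 ≤ lam), ⨆ s : State d U M N, (ρ lam s : EReal)) ≤
      S.encoderOptimalDistortion d dec act := by
  rw [EReal.neg_le]
  refine le_iInf₂ fun lam hlam => ?_
  obtain ⟨s, hs⟩ := Finite.exists_max (ρ lam)
  refine le_trans ?_ (le_iSup (fun s => (ρ lam s : EReal)) s)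
  rw [EReal.neg_le, ← EReal.coe_neg]
  exact le_iInf fun ν => le_iInf₂ fun e hcost =>
    S.neg_le_avgDistortion dec act hlam (hACOE lam hlam) hs ν e hcost

end VendingMachine

end

theorem theorem6 {U X Y A M N R : Type*} [Fintype U] [Fintype X] [Fintype Y] [Fintype A]
    [Fintype M] [Fintype N] [Fintype R]
    (S : VendingMachine U X Y A M N R) (d : ℕ)
    (dec : VendingMachine.Decoder X Y M N R) (act : VendingMachine.Actuator X A M)
    (ρ h : ℝ → VendingMachine.State d U M N → ℝ)
    (hACOE : ∀ lam : ℝ, 0 ≤ lam → S.SolvesACOE dec act lam (ρ lam) (h lam)) :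
    S.encoderOptimalDistortion d dec act
        = -(⨅ (lam : ℝ) (_ : 0 ≤ lam), ⨆ x : VendingMachine.State d U M N, (ρ lam x : EReal)) ∧
      (S.IsOptimalPair d dec act →
        S.optimalDistortion d
          = -(⨅ (lam : ℝ) (_ : 0 ≤ lam),
              ⨆ x : VendingMachine.State d U M N, (ρ lam x : EReal))) := by
  have hmain : S.encoderOptimalDistortion d dec act
      = -(⨅ (lam : ℝ) (_ : 0 ≤ lam),
          ⨆ x : VendingMachine.State d U M N, (ρ lam x : EReal)) := by
    -- Without states there is no initial law: the infimum over laws is `⊤` and the supremum of `ρ`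
    -- is `⊥`.
    rcases isEmpty_or_nonempty (VendingMachine.State d U M N) with hempty | hne
    · have hν : IsEmpty (stdSimplex ℝ (VendingMachine.State d U M N)) :=
        ⟨fun ν => by simpa using ν.2.2⟩
      rw [VendingMachine.encoderOptimalDistortion, iInf_of_empty, eq_comm, EReal.neg_eq_top_iff,
        eq_bot_iff]
      exact iInf₂_le_of_le 0 le_rfl (by rw [iSup_of_empty])
    · exact le_antisymm (S.encoderOptimalDistortion_le_neg_iInf dec act hACOE)
        (S.neg_iInf_le_encoderOptimalDistortion dec act hACOE)
  refine ⟨hmain, fun hopt => hmain ▸ ?_⟩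
  unfold VendingMachine.optimalDistortion
  apply le_antisymm
  · exact iInf_le_of_le dec (iInf_le_of_le act le_rfl)
  · exact le_iInf fun dec' => le_iInf fun act' => hopt dec' act'
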